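/- Fix a universal machine $U$: a partial computable map from finite binary words (programs) to finite sets of rational points of $\mathbb{R}$ (printed as finite lists) such that for every partial computable map $V$ of this kind there is a constant $c$ such that whatever $V$ prints on a program $p$ is printed by $U$ on some program of length at most $|p|+c$. For a closed set $F\subset\mathbb{R}$ and $\epsilon>0$, the $\epsilon$-distortion complexity $\Delta_\epsilon(F)$ is the least length of a program on which $U$ halts and prints a finite set at Hausdorff distance at most $\epsilon$ from $F$. A hyperbolic iterated function system with injective contractions (IHIFS) on $[0,1]$ is a finite family, with at least two members, of injective maps $\phi_i:[0,1]\to[0,1]$, all Lipschitz with a common constant in $(0,1)$, with pairwise disjoint images. It generates the set $$\mathcal{C}(\phi)=\bigcup_{\omega}\ \bigcap_{n\ge 0}\ \phi_{\omega_0}\circ\cdots\circ\phi_{\omega_n}([0,1]),$$ the union being over all infinite sequences of indices. For $R>1/2$, $0<\tilde\rho<\rho<1/2$ and $Q>1+R/2$, let $\mathcal{K}_R(\tilde\rho,\rho,Q)$ be the set of pairs $(\phi_0,\phi_1)$ of functions that are analytic with modulus at most $Q$ in the open complex disk of centre $1/2$ and radius $R$, map the interval $[0,1]$ into itself, satisfy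 $\tilde\rho\le\phi_i'(x)\le\rho$ for $x\in[0,1]$, and satisfy $\phi_0(0)=0$ and $\phi_1(1)=1$. **Theorem.** For all $R>1/2$, $0<\tilde\rho<\rho<1/2$ and $Q>1+R/2$ there is a pair $\phi=(\phi_0,\phi_1)\in\mathcal{K}_R(\tilde\rho,\rho,Q)$ such that $\phi$ restricted to $[0,1]$ is a real-analytic IHIFS, the set $\mathcal{C}(\phi)$ is a Cantor set (it is homeomorphic to $\{0,1\}^{\mathbb{N}}$), and $$\liminf_{\epsilon\to 0^+}\frac{\Delta_\epsilon(\mathcal{C}(\phi))}{(\log\epsilon^{-1})^2}>0.$$ -/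

import Mathlib

open Set Filter Topology
open scoped ENNReal

namespace DistortionComplexity

noncomputable section

/-! ### Programs, universal machines and the distortion complexity -/

/-- A machine reads a finite binary program and, if it halts, prints a finite list of rational
numbers. A pair `(a, b)` of the list stands for the rational number `a / (b + 1)`. -/
abbrev Machine := List Bool →. List (ℤ × ℕ)

/-- The finite set of points of the line described by a printed list. -/
def points (l : List (ℤ × ℕ)) : Set ℝ :=
  {x | ∃ q ∈ l, x = (q.1 : ℝ) / ((q.2 : ℝ) + 1)}

/-- A universal machine: it is partial computable, and it simulates every partial computable
machine at the price of an additive constant in the program length. -/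
def IsUniversal (U : Machine) : Prop :=
  Partrec U ∧ ∀ V : Machine, Partrec V →
    ∃ c : ℕ, ∀ p : List Bool, ∀ l ∈ V p, ∃ q : List Bool, q.length ≤ p.length + c ∧ l ∈ U q

/-- The `ε`-distortion complexity of a set `F` of the line, relative to the machine `U`: the
least length of a program that halts and prints a finite set within Hausdorff distance `ε`
of `F`. The extended distance is used, so the empty set is at infinite distance from every
nonempty set. -/
def distortionComplexity (U : Machine) (ε : ℝ) (F : Set ℝ) : ℕ∞ :=
  ⨅ p ∈ {p : List Bool | ∃ l ∈ U p, Metric.hausdorffEDist F (points l) ≤ ENNReal.ofReal ε},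
    (p.length : ℕ∞)

/-! ### Iterated function systems on the unit interval -/

/-- A hyperbolic iterated function system on `[0, 1]` with injective contractions. -/
structure IsIHIFS {ι : Type*} (φ : ι → ℝ → ℝ) : Prop where
  finite : Finite ι
  nontrivial : Nontrivial ι
  mapsTo : ∀ i, MapsTo (φ i) (Icc 0 1) (Icc 0 1)
  contracting : ∃ ρ : NNReal, 0 < ρ ∧ ρ < 1 ∧ ∀ i, LipschitzOnWith ρ (φ i) (Icc 0 1)
  injOn : ∀ i, InjOn (φ i) (Icc 0 1)
  disjoint : ∀ i j, i ≠ j → Disjoint (φ i '' Icc 0 1) (φ j '' Icc 0 1)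

/-- The composition `φ (ω 0) ∘ φ (ω 1) ∘ ⋯ ∘ φ (ω (n - 1))`. -/
def wordMap {ι : Type*} (φ : ι → ℝ → ℝ) (ω : ℕ → ι) : ℕ → ℝ → ℝ
  | 0 => id
  | n + 1 => wordMap φ ω n ∘ φ (ω n)

/-- The set generated by an iterated function system on `[0, 1]`. -/
def attractor {ι : Type*} (φ : ι → ℝ → ℝ) : Set ℝ :=
  ⋃ ω : ℕ → ι, ⋂ n : ℕ, wordMap φ ω (n + 1) '' Icc 0 1

/-- A set of the line is a Cantor set if it is homeomorphic to the space of binary sequences. -/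
def IsCantorSet (C : Set ℝ) : Prop :=
  Nonempty (C ≃ₜ (ℕ → Bool))

/-! ### The analytic classes -/

/-- The functions that are analytic and bounded by `Q` in the complex disk of centre `1/2` and
radius `R`, and that map the real interval `[0, 1]` into itself with derivative (a real number
there) between `ρ'` and `ρ`. -/
def analyticClass (R ρ' ρ Q : ℝ) : Set (ℂ → ℂ) :=
  {f | AnalyticOnNhd ℂ f (Metric.ball (1 / 2 : ℂ) R) ∧
    (∀ z ∈ Metric.ball (1 / 2 : ℂ) R, ‖f z‖ ≤ Q) ∧
    (∀ x ∈ Icc (0 : ℝ) 1, ∃ y ∈ Icc (0 : ℝ) 1, f (x : ℂ) = (y : ℂ)) ∧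
    ∀ x ∈ Icc (0 : ℝ) 1, ρ' ≤ (deriv f (x : ℂ)).re ∧ (deriv f (x : ℂ)).re ≤ ρ}

/-- The pairs of functions of the analytic class such that the first one fixes `0` and the
second one fixes `1`. -/
def analyticPairs (R ρ' ρ Q : ℝ) : Set (Fin 2 → ℂ → ℂ) :=
  {φ | (∀ i, φ i ∈ analyticClass R ρ' ρ Q) ∧ φ 0 0 = 0 ∧ φ 1 1 = 1}

/-- The maps of the real line induced by complex functions that are real on `[0, 1]`. -/
def realMaps {ι : Type*} (φ : ι → ℂ → ℂ) (i : ι) (x : ℝ) : ℝ :=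
  (φ i (x : ℂ)).re

/-! ### Universal machines exist -/

/-- The machine that reads `1 ⋯ 1 0 p` with `n` ones, and runs the `n`-th code on `p`. -/
def standardMachine : Machine := fun q =>
  ((Nat.Partrec.Code.ofNatCode (q.findIdx (fun b => !b))).eval
    (Encodable.encode ((List.tail)^[q.findIdx (fun b => !b) + 1] q))).bind
    fun m => (Encodable.decode m : Option (List (ℤ × ℕ)))

theorem isUniversal_standardMachine : IsUniversal standardMachine := by
  have hn : Primrec (fun q : List Bool => q.findIdx (fun b => !b)) :=
    Primrec.list_findIdx Primrec.id (Primrec.not.comp Primrec.snd).to₂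
  have hit : ∀ (n : ℕ) (q : List Bool),
      (Nat.rec q (fun _ t => t.tail) n : List Bool) = (List.tail)^[n] q := by
    intro n q
    induction n with
    | zero => rfl
    | succ n ih => rw [Function.iterate_succ_apply', ← ih]
  have hd : Primrec (fun q : List Bool => (List.tail)^[q.findIdx (fun b => !b) + 1] q) := by
    refine (Primrec.nat_rec' (f := fun q : List Bool => q.findIdx (fun b => !b) + 1)
      (g := fun q => q) (h := fun _ p => p.2.tail) (Primrec.succ.comp hn) Primrec.id
      (Primrec.list_tail.comp (Primrec.snd.comp Primrec.snd)).to₂).of_eq ?_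
    intro q
    exact hit (q.findIdx (fun b => !b) + 1) q
  constructor
  · refine Partrec.bind (Nat.Partrec.Code.eval_part.comp
      ((Primrec.ofNat Nat.Partrec.Code).comp hn).to_comp
      (Primrec.encode.comp hd).to_comp) ?_
    exact (Computable.ofOption (Computable.decode.comp Computable.snd)).to₂
  · intro V hV
    obtain ⟨c, hc⟩ := Nat.Partrec.Code.exists_code.1 hV
    refine ⟨Encodable.encode c + 1, fun p l hl =>
      ⟨List.replicate (Encodable.encode c) true ++ false :: p, ?_, ?_⟩⟩
    · simp; omega
    · have h1 : ∀ n : ℕ, (List.replicate n true ++ false :: p).findIdx (fun b => !b) = n := by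
        intro n
        induction n with
        | zero => simp [List.findIdx_cons]
        | succ n ih => simp [List.replicate_succ, List.findIdx_cons, ih]
      have h2 : ∀ n : ℕ, (List.tail)^[n + 1] (List.replicate n true ++ false :: p) = p := by
        intro n
        induction n with
        | zero => rfl
        | succ n ih => rw [Function.iterate_succ_apply]; simpa [List.replicate_succ] using ih
      have h3 : Nat.Partrec.Code.ofNatCode (Encodable.encode c) = c := by
        rw [← Nat.Partrec.Code.ofNatCode_eq, Denumerable.ofNat_encode]
      simp only [standardMachine, h1, h2, h3, hc]
      simp only [Encodable.encodek, Part.coe_some, Part.bind_some]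
      simp only [Part.mem_bind_iff, Part.mem_map_iff]
      exact ⟨_, ⟨l, hl, rfl⟩, by simp⟩

end

end DistortionComplexity

/-! The set is built so that its geometry at precision `ε` stores about `(log ε⁻¹) ^ 2` bits that no
short program can supply. Put `K = 2 ^ k`. The second map is affine with slope `l`, and the first is
`x ↦ x * (l + f x)` with `f = ∑ p_k`, where `p_k` has degree less than `K` and coefficients `a ^ K *
c_j` with integers `0 ≤ c_j < 2 ^ K`. Block `k` thus carries `K * K = 4 ^ k` bits, while `|p_k| ≤ t
^ K` on a fixed disk, with `t = 4 * a * B`. For small `t` every choice of blocks gives an admissible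
pair.

The core is `block_eq_of_hausdorffEDist_lt`: once the blocks before `k` are known, the attractor at
precision `t ^ (2 * K)` determines block `k`. Two pairs with the same earlier blocks are `4 * t ^
K`-close, which is below the separation of cylinders of level at most `k + 1`. Comparing the
attractors therefore matches cylinders with the same word, and the matched right endpoints agree up
to order `t ^ (2 * K)` (`IsSlopePair.abs_endpoint_sub_le`). An endpoint `x` of level `k` and its
image under the first map are both such endpoints, so the two first maps nearly agree at the `2 ^ k`
endpoints of level `k`. Up to the later blocks, which are of order `t ^ (2 * K)`, the difference of
the two polynomials `p_k` is thus tiny at `2 ^ k` nodes. These are well spread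
(`IsSlopePair.pow_le_prod_nodes`), so Lagrange interpolation loses only a factor exponential in `K`
and makes every coefficient smaller than `a ^ K`. Those coefficients are integer multiples of `a ^
K`, hence zero.

Consequently one printed set approximates at precision `t ^ (2 * K)` the attractors for at most one
value of block `k`, given the earlier ones. There are `2 ^ 4 ^ k` values and fewer programs of
length below `4 ^ k`, so a value escapes them all; choosing blocks successively
(`exists_blocks_not_excluded`) yields one pair that works at all scales. Since `log ε⁻¹` is
proportional to `2 ^ k` at these precisions, `4 ^ k` is of order `(log ε⁻¹) ^ 2`. -/

namespace DistortionComplexity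

/-! ### Pairs of increasing contractions with slopes in a fixed range -/

/-- A pair of maps of `[0, 1]` that fix `0` and `1` respectively, and whose slopes lie between
`s > 0` and `r < 1 / 2`. -/
structure IsSlopePair (s r : ℝ) (ψ : Fin 2 → ℝ → ℝ) : Prop where
  pos : 0 < s
  lt_half : r < 1 / 2
  zero : ψ 0 0 = 0
  one : ψ 1 1 = 1
  slope : ∀ i, ∀ x ∈ Icc (0 : ℝ) 1, ∀ y ∈ Icc (0 : ℝ) 1, x ≤ y →
    s * (y - x) ≤ ψ i y - ψ i x ∧ ψ i y - ψ i x ≤ r * (y - x)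

/-- The composition of the maps of a family along a finite word. -/
def listMap {ι : Type*} (ψ : ι → ℝ → ℝ) : List ι → ℝ → ℝ
  | [] => id
  | i :: w => ψ i ∘ listMap ψ w

theorem listMap_append {ι : Type*} (ψ : ι → ℝ → ℝ) (v w : List ι) :
    listMap ψ (v ++ w) = listMap ψ v ∘ listMap ψ w := by
  induction v with
  | nil => rfl
  | cons i v ih => simp only [List.cons_append, listMap, ih]; rfl

theorem wordMap_eq_listMap {ι : Type*} (ψ : ι → ℝ → ℝ) (ω : ℕ → ι) (n : ℕ) :
    wordMap ψ ω n = listMap ψ ((List.range n).map ω) := by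
  induction n with
  | zero => rfl
  | succ n ih =>
    rw [List.range_succ, List.map_append, listMap_append, ← ih]
    rfl

theorem wordMap_cons {ι : Type*} (ψ : ι → ℝ → ℝ) (ω ω' : ℕ → ι) (i : ι) (h0 : ω' 0 = i)
    (h : ∀ n, ω' (n + 1) = ω n) (n : ℕ) :
    wordMap ψ ω' (n + 1) = ψ i ∘ wordMap ψ ω n := by
  induction n with
  | zero => simp only [wordMap, h0]; rfl
  | succ n ih => rw [wordMap, ih, h]; rfl

namespace IsSlopePair

variable {s r : ℝ} {ψ : Fin 2 → ℝ → ℝ}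

theorem le (h : IsSlopePair s r ψ) : s ≤ r := by
  have := h.slope 0 0 (by simp) 1 (by simp) zero_le_one
  linarith [this.1, this.2]

theorem abs_slope (h : IsSlopePair s r ψ) (i : Fin 2) {x y : ℝ} (hx : x ∈ Icc (0 : ℝ) 1)
    (hy : y ∈ Icc (0 : ℝ) 1) :
    s * |x - y| ≤ |ψ i x - ψ i y| ∧ |ψ i x - ψ i y| ≤ r * |x - y| := by
  have key : ∀ x ∈ Icc (0 : ℝ) 1, ∀ y ∈ Icc (0 : ℝ) 1, x ≤ y →
      s * |x - y| ≤ |ψ i x - ψ i y| ∧ |ψ i x - ψ i y| ≤ r * |x - y| := by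
    intro x hx y hy hxy
    have h1 := h.slope i x hx y hy hxy
    have h2 : 0 ≤ s * (y - x) := mul_nonneg h.pos.le (sub_nonneg.2 hxy)
    rw [abs_of_nonpos (by linarith : x - y ≤ 0), abs_of_nonpos (by linarith : ψ i x - ψ i y ≤ 0)]
    constructor <;> linarith [h1.1, h1.2]
  rcases le_total x y with hxy | hxy
  · exact key x hx y hy hxy
  · rw [abs_sub_comm x y, abs_sub_comm (ψ i x)]
    exact key y hy x hx hxy

theorem zero_image (h : IsSlopePair s r ψ) {x : ℝ} (hx : x ∈ Icc (0 : ℝ) 1) :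
    s * x ≤ ψ 0 x ∧ ψ 0 x ≤ r := by
  have := h.slope 0 0 (by simp) x hx hx.1
  rw [h.zero] at this
  have := h.pos
  have := h.le
  constructor
  · linarith
  · nlinarith [hx.2]

theorem one_image (h : IsSlopePair s r ψ) {x : ℝ} (hx : x ∈ Icc (0 : ℝ) 1) :
    1 - r ≤ ψ 1 x ∧ ψ 1 x ≤ 1 := by
  have h1 := h.slope 1 x hx 1 (by simp) hx.2
  rw [h.one] at h1
  have := h.pos
  have := h.le
  constructor
  · nlinarith [hx.1]
  · nlinarith [hx.2]

theorem mapsTo (h : IsSlopePair s r ψ) (i : Fin 2) : MapsTo (ψ i) (Icc 0 1) (Icc 0 1) := by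
  intro x hx
  have h1 := h.lt_half
  have h2 := h.pos
  fin_cases i
  · have h3 := h.zero_image hx
    exact ⟨(mul_nonneg h2.le hx.1).trans h3.1, by simpa using h3.2.trans (by linarith)⟩
  · have h3 := h.one_image hx
    exact ⟨by simpa using (by linarith : (0 : ℝ) ≤ ψ 1 x), h3.2⟩

theorem gap (h : IsSlopePair s r ψ) {i j : Fin 2} (hij : i ≠ j) {x y : ℝ}
    (hx : x ∈ Icc (0 : ℝ) 1) (hy : y ∈ Icc (0 : ℝ) 1) : 1 - 2 * r ≤ |ψ i x - ψ j y| := by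
  have key : ∀ x ∈ Icc (0 : ℝ) 1, ∀ y ∈ Icc (0 : ℝ) 1, 1 - 2 * r ≤ |ψ 0 x - ψ 1 y| := by
    intro x hx y hy
    have h1 := h.zero_image hx
    have h2 := h.one_image hy
    rw [abs_sub_comm]
    exact le_trans (by linarith [h1.2, h2.1]) (le_abs_self _)
  fin_cases i <;> fin_cases j
  · exact absurd rfl hij
  · exact key x hx y hy
  · rw [abs_sub_comm]; exact key y hy x hx
  · exact absurd rfl hij

theorem listMap_mem (h : IsSlopePair s r ψ) (w : List (Fin 2)) {x : ℝ}
    (hx : x ∈ Icc (0 : ℝ) 1) : listMap ψ w x ∈ Icc (0 : ℝ) 1 := by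
  induction w with
  | nil => exact hx
  | cons i w ih => exact h.mapsTo i ih

theorem listMap_mono (h : IsSlopePair s r ψ) (w : List (Fin 2)) {x y : ℝ}
    (hx : x ∈ Icc (0 : ℝ) 1) (hy : y ∈ Icc (0 : ℝ) 1) (hxy : x ≤ y) :
    listMap ψ w x ≤ listMap ψ w y := by
  induction w with
  | nil => exact hxy
  | cons i w ih =>
    have h1 := (h.slope i _ (h.listMap_mem w hx) _ (h.listMap_mem w hy) ih).1
    have h2 := mul_nonneg h.pos.le (sub_nonneg.2 ih)
    simp only [listMap, Function.comp]
    linarith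

theorem abs_listMap_sub_le (h : IsSlopePair s r ψ) (w : List (Fin 2)) {x y : ℝ}
    (hx : x ∈ Icc (0 : ℝ) 1) (hy : y ∈ Icc (0 : ℝ) 1) :
    |listMap ψ w x - listMap ψ w y| ≤ r ^ w.length := by
  induction w with
  | nil =>
    simp only [listMap, id, List.length_nil, pow_zero]
    exact abs_le.2 ⟨by linarith [hx.1, hy.2], by linarith [hx.2, hy.1]⟩
  | cons i w ih =>
    refine (h.abs_slope i (h.listMap_mem w hx) (h.listMap_mem w hy)).2.trans ?_
    rw [List.length_cons, pow_succ']
    exact mul_le_mul_of_nonneg_left ih (h.pos.le.trans h.le)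

/-- Cylinders of different words of the same length are separated. -/
theorem separation (h : IsSlopePair s r ψ) : ∀ (v w : List (Fin 2)), v.length = w.length →
    v ≠ w → ∀ {x y : ℝ}, x ∈ Icc (0 : ℝ) 1 → y ∈ Icc (0 : ℝ) 1 →
    (1 - 2 * r) * s ^ w.length ≤ |listMap ψ v x - listMap ψ w y|
  | [], [], _, hne, _, _, _, _ => absurd rfl hne
  | [], _ :: _, hl, _, _, _, _, _ => by simp at hl
  | _ :: _, [], hl, _, _, _, _, _ => by simp at hl
  | i :: v, j :: w, hl, hne, x, y, hx, hy => by
    have h1 := h.lt_half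
    have hs1 : s ≤ 1 := by linarith [h.le]
    simp only [listMap, Function.comp]
    -- A common first letter costs at most a factor `s`; at the first disagreement the images are `1
    -- - 2 * r` apart.
    by_cases hij : i = j
    · subst hij
      have hl' : v.length = w.length := by simpa using hl
      have hne' : v ≠ w := fun e => hne (by rw [e])
      refine le_trans ?_ (h.abs_slope i (h.listMap_mem v hx) (h.listMap_mem w hy)).1
      have := mul_le_mul_of_nonneg_left (h.separation v w hl' hne' hx hy) h.pos.le
      rw [List.length_cons, pow_succ]
      linarith
    · refine le_trans ?_ (h.gap hij (h.listMap_mem v hx) (h.listMap_mem w hy))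
      exact mul_le_of_le_one_right (by linarith) (pow_le_one₀ h.pos.le hs1)

/-- A letter `0` shrinks by at most `s`, and a letter `1` lands above `1 - r > 1 / 2`. The bound
allows division by the factor `x` in the first map of a `blockPair`. -/
theorem pow_le_listMap_one (h : IsSlopePair s r ψ) (w : List (Fin 2)) :
    s ^ w.length ≤ listMap ψ w 1 := by
  have h0 := h.pos
  have h1 := h.lt_half
  have h2 := h.le
  induction w with
  | nil => simp [listMap]
  | cons i w ih =>
    have hm := h.listMap_mem w (x := 1) (by simp)
    rw [List.length_cons, pow_succ']
    simp only [listMap, Function.comp]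
    fin_cases i
    · exact (mul_le_mul_of_nonneg_left ih h0.le).trans (h.zero_image hm).1
    · refine le_trans ?_ (h.one_image hm).1
      have : s ^ w.length ≤ 1 := pow_le_one₀ h0.le (by linarith)
      nlinarith

/-- Close pairs have close cylinders. -/
theorem abs_listMap_sub_listMap_le (h : IsSlopePair s r ψ) {ψ' : Fin 2 → ℝ → ℝ}
    (h' : IsSlopePair s r ψ') {H : ℝ}
    (hH : ∀ i, ∀ x ∈ Icc (0 : ℝ) 1, |ψ i x - ψ' i x| ≤ H) (w : List (Fin 2)) {x : ℝ}
    (hx : x ∈ Icc (0 : ℝ) 1) : |listMap ψ w x - listMap ψ' w x| ≤ 2 * H := by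
  have hH0 : 0 ≤ H := (abs_nonneg _).trans (hH 0 0 (by simp))
  induction w with
  | nil => simpa [listMap] using hH0
  -- The bound `2 * H` is stable: one more letter gives at most `H + r * (2 * H) ≤ 2 * H` because `r
  -- < 1 / 2`.
  | cons i w ih =>
    have hm := h.listMap_mem w hx
    have hm' := h'.listMap_mem w hx
    have h1 := (h.abs_slope i hm hm').2
    have h2 := hH i _ hm'
    have h3 := abs_sub_le (ψ i (listMap ψ w x)) (ψ i (listMap ψ' w x)) (ψ' i (listMap ψ' w x))
    have h4 : r * |listMap ψ w x - listMap ψ' w x| ≤ 1 / 2 * (2 * H) :=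
      mul_le_mul h.lt_half.le ih (abs_nonneg _) (by norm_num)
    simp only [listMap, Function.comp]
    linarith

theorem isIHIFS (h : IsSlopePair s r ψ) : IsIHIFS ψ := by
  have h0 := h.pos
  have h1 := h.lt_half
  have h2 := h.le
  refine ⟨inferInstance, inferInstance, h.mapsTo, ?_, ?_, ?_⟩
  · refine ⟨⟨r, by linarith⟩, ?_, ?_, fun i => ?_⟩
    · exact_mod_cast (by linarith : 0 < r)
    · exact_mod_cast (by linarith : r < 1)
    · refine LipschitzOnWith.of_dist_le_mul fun x hx y hy => ?_
      rw [Real.dist_eq, Real.dist_eq]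
      exact (h.abs_slope i hx hy).2
  · intro i x hx y hy hxy
    have h3 := (h.abs_slope i hx hy).1
    rw [hxy, sub_self, abs_zero] at h3
    have h4 : |x - y| ≤ 0 := by
      by_contra hc
      have := mul_pos h0 (not_le.1 hc)
      linarith
    linarith [abs_eq_zero.1 (le_antisymm h4 (abs_nonneg _))]
  · intro i j hij
    rw [Set.disjoint_left]
    rintro _ ⟨x, hx, rfl⟩ ⟨y, hy, hxy⟩
    have h3 := h.gap hij hx hy
    rw [hxy, sub_self, abs_zero] at h3
    linarith

/-! ### The attractor of a slope pair -/

theorem exists_word_of_mem_attractor {x : ℝ} (hx : x ∈ attractor ψ) {n : ℕ} (hn : n ≠ 0) :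
    ∃ w : List (Fin 2), w.length = n ∧ ∃ y ∈ Icc (0 : ℝ) 1, listMap ψ w y = x := by
  obtain ⟨ω, hω⟩ := mem_iUnion.1 hx
  obtain ⟨m, rfl⟩ := Nat.exists_eq_succ_of_ne_zero hn
  obtain ⟨y, hy, hyx⟩ := mem_iInter.1 hω m
  exact ⟨(List.range (m + 1)).map ω, by simp, y, hy, by rw [← wordMap_eq_listMap, hyx]⟩

theorem map_mem_attractor (h : IsSlopePair s r ψ) (i : Fin 2) {x : ℝ} (hx : x ∈ attractor ψ) :
    ψ i x ∈ attractor ψ := by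
  obtain ⟨ω, hω⟩ := mem_iUnion.1 hx
  rw [mem_iInter] at hω
  refine mem_iUnion.2 ⟨fun n => Nat.casesOn n i ω, mem_iInter.2 fun n => ?_⟩
  rw [wordMap_cons ψ ω _ i rfl (fun _ => rfl), image_comp]
  refine mem_image_of_mem _ ?_
  cases n with
  | zero =>
    obtain ⟨y, hy, rfl⟩ := hω 0
    exact ⟨_, h.mapsTo (ω 0) hy, rfl⟩
  | succ n => exact hω n

theorem one_mem_attractor (h : IsSlopePair s r ψ) : 1 ∈ attractor ψ := by
  refine mem_iUnion.2 ⟨fun _ => 1, mem_iInter.2 fun n => ⟨1, by simp, ?_⟩⟩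
  generalize n + 1 = m
  induction m with
  | zero => rfl
  | succ m ih => rw [wordMap, Function.comp, h.one, ih]

theorem listMap_one_mem_attractor (h : IsSlopePair s r ψ) (w : List (Fin 2)) :
    listMap ψ w 1 ∈ attractor ψ := by
  induction w with
  | nil => exact h.one_mem_attractor
  | cons i w ih => exact h.map_mem_attractor i ih

theorem listMap_continuousOn (h : IsSlopePair s r ψ) (w : List (Fin 2)) :
    ContinuousOn (listMap ψ w) (Icc 0 1) := by
  obtain ⟨ρ, -, -, hρ⟩ := h.isIHIFS.contracting
  induction w with
  | nil => exact continuousOn_id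
  | cons i w ih => exact (hρ i).continuousOn.comp ih fun x hx => h.listMap_mem w hx

theorem exists_code (h : IsSlopePair s r ψ) (ω : ℕ → Fin 2) :
    (⋂ n : ℕ, wordMap ψ ω (n + 1) '' Icc 0 1).Nonempty := by
  have hc : ∀ n, IsCompact (wordMap ψ ω (n + 1) '' Icc 0 1) := fun n => by
    rw [wordMap_eq_listMap]
    exact isCompact_Icc.image_of_continuousOn (h.listMap_continuousOn _)
  refine IsCompact.nonempty_iInter_of_sequence_nonempty_isCompact_isClosed _ (fun n => ?_)
    (fun n => ?_) (hc 0) fun n => (hc n).isClosed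
  · rw [wordMap, image_comp]
    exact image_mono (image_subset_iff.2 (h.mapsTo _))
  · exact (nonempty_Icc.2 zero_le_one).image _

/-- The attractor of a slope pair is a Cantor set. -/
theorem isCantorSet (h : IsSlopePair s r ψ) : IsCantorSet (attractor ψ) := by
  -- `π` sends a sequence to the point it codes. It is a continuous injection of a compact space,
  -- hence a closed embedding, with range the attractor.
  choose π hπ using h.exists_code
  have hπ' : ∀ ω n, ∃ y ∈ Icc (0 : ℝ) 1, listMap ψ ((List.range n).map ω) y = π ω := by
    intro ω n
    obtain ⟨y, hy, e⟩ := mem_iInter.1 (hπ ω) n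
    rw [wordMap] at e
    exact ⟨ψ (ω n) y, h.mapsTo _ hy, by rw [← e, ← wordMap_eq_listMap]; rfl⟩
  have hr0 : 0 ≤ r := h.pos.le.trans h.le
  have hr1 : r < 1 := by linarith [h.lt_half]
  have hclose : ∀ ω n, ∀ x ∈ wordMap ψ ω n '' Icc 0 1, |x - π ω| ≤ r ^ n := by
    rintro ω n _ ⟨x, hx, rfl⟩
    obtain ⟨y, hy, e⟩ := hπ' ω n
    rw [wordMap_eq_listMap, ← e]
    simpa using h.abs_listMap_sub_le ((List.range n).map ω) hx hy
  have hcont : Continuous π := by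
    refine continuous_iff_continuousAt.2 fun ω => Metric.tendsto_nhds.2 fun ε hε => ?_
    obtain ⟨n, hn⟩ := exists_pow_lt_of_lt_one hε hr1
    filter_upwards [(PiNat.isOpen_cylinder (fun _ => Fin 2) ω n).mem_nhds
      (PiNat.self_mem_cylinder ω n)] with ω' hω'
    refine lt_of_le_of_lt ?_ hn
    obtain ⟨y, hy, e⟩ := hπ' ω' n
    refine hclose ω n _ ⟨y, hy, ?_⟩
    rw [← e, wordMap_eq_listMap]
    congr 1
    refine List.map_congr_left fun i hi => ?_
    exact (hω' i (List.mem_range.1 hi)).symm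
  have hinj : Function.Injective π := by
    intro ω ω' e
    by_contra hne
    obtain ⟨n, hn⟩ := Function.ne_iff.1 hne
    obtain ⟨y, hy, e1⟩ := hπ' ω (n + 1)
    obtain ⟨y', hy', e2⟩ := hπ' ω' (n + 1)
    have hne' : (List.range (n + 1)).map ω ≠ (List.range (n + 1)).map ω' := by
      intro e3
      exact hn (List.map_inj_left.1 e3 n (by simp))
    have := h.separation _ _ (by simp) hne' hy hy'
    rw [e1, e2, e, sub_self, abs_zero] at this
    have h1 : 0 < 1 - 2 * r := by linarith [h.lt_half]
    exact absurd this (not_le.2 (mul_pos h1 (pow_pos h.pos _)))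
  have hrange : range π = attractor ψ := by
    apply subset_antisymm
    · rintro _ ⟨ω, rfl⟩
      exact mem_iUnion.2 ⟨ω, hπ ω⟩
    · intro x hx
      obtain ⟨ω, hω⟩ := mem_iUnion.1 hx
      refine ⟨ω, ?_⟩
      have h1 : ∀ n, |x - π ω| ≤ r ^ n := by
        intro n
        refine (hclose ω (n + 1) x (mem_iInter.1 hω n)).trans ?_
        exact pow_le_pow_of_le_one hr0 hr1.le (Nat.le_succ n)
      have h2 := ge_of_tendsto' (tendsto_pow_atTop_nhds_zero_of_lt_one hr0 hr1) h1
      linarith [abs_eq_zero.1 (le_antisymm h2 (abs_nonneg _))]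
  rw [IsCantorSet, ← hrange]
  have e1 : (ℕ → Fin 2) ≃ₜ range π :=
    (hcont.isClosedEmbedding hinj).isEmbedding.toHomeomorph
  have e2 : (ℕ → Fin 2) ≃ₜ (ℕ → Bool) :=
    Homeomorph.piCongrRight fun _ =>
      { toEquiv := finTwoEquiv
        continuous_toFun := continuous_of_discreteTopology
        continuous_invFun := continuous_of_discreteTopology }
  exact ⟨e1.symm.trans e2⟩

/-- If two close pairs have attractors at Hausdorff distance less than `δ`, then the right
endpoints of their cylinders are `δ`-close. -/
theorem abs_endpoint_sub_le (h : IsSlopePair s r ψ) {ψ' : Fin 2 → ℝ → ℝ}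
    (h' : IsSlopePair s r ψ') {H δ : ℝ}
    (hH : ∀ i, ∀ x ∈ Icc (0 : ℝ) 1, |ψ i x - ψ' i x| ≤ H)
    (hd : Metric.hausdorffEDist (attractor ψ) (attractor ψ') < ENNReal.ofReal δ)
    (w : List (Fin 2)) (hw : 2 * H + δ ≤ (1 - 2 * r) * s ^ w.length) :
    |listMap ψ w 1 - listMap ψ' w 1| ≤ δ := by
  -- One-sided estimate, then applied in both directions. A point of the second attractor within `δ`
  -- of the endpoint lies within `2 * H + δ` of the corresponding endpoint, too near to belong to
  -- another cylinder of that level. So it lies in the same cylinder, below its right endpoint.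
  have key : ∀ {ψ ψ' : Fin 2 → ℝ → ℝ}, IsSlopePair s r ψ → IsSlopePair s r ψ' →
      |listMap ψ w 1 - listMap ψ' w 1| ≤ 2 * H →
      Metric.hausdorffEDist (attractor ψ) (attractor ψ') < ENNReal.ofReal δ →
      listMap ψ w 1 - δ ≤ listMap ψ' w 1 := by
    intro ψ ψ' h h' hH hd
    obtain ⟨y, hy, hxy⟩ := Metric.exists_edist_lt_of_hausdorffEDist_lt
      (h.listMap_one_mem_attractor w) hd
    rw [edist_dist, ENNReal.ofReal_lt_ofReal_iff_of_nonneg dist_nonneg, Real.dist_eq,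
      abs_lt] at hxy
    -- The attractor is described by words of positive length only; for the empty word both
    -- endpoints are `1`.
    rcases Nat.eq_zero_or_pos w.length with h0 | h0
    · have hw0 : w = [] := List.length_eq_zero_iff.1 h0
      subst hw0
      have : 0 < δ := by linarith
      simp only [listMap, id]
      linarith
    obtain ⟨v, hv, u, hu, rfl⟩ := exists_word_of_mem_attractor hy h0.ne'
    by_cases hvw : v = w
    · subst hvw
      linarith [h'.listMap_mono v hu (y := 1) (by simp) hu.2]
    · have h1 := h'.separation v w hv hvw hu (y := 1) (by simp)
      have h2 : |listMap ψ' v u - listMap ψ' w 1| < 2 * H + δ := by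
        rw [abs_le] at hH
        rw [abs_lt]
        constructor <;> linarith
      linarith
  have hap := h.abs_listMap_sub_listMap_le h' hH w (x := 1) (by simp)
  have h1 := key h h' hap hd
  have h2 := key h' h (by rwa [abs_sub_comm]) (by rwa [Metric.hausdorffEDist_comm])
  rw [abs_le]
  constructor <;> linarith

end IsSlopePair

/-! ### Endpoints of cylinders as interpolation nodes -/

/-- The right endpoints of the cylinders of level `k`. -/
noncomputable def nodes (ψ : Fin 2 → ℝ → ℝ) : ℕ → Finset ℝ
  | 0 => {1}
  | k + 1 => (nodes ψ k).image (ψ 0) ∪ (nodes ψ k).image (ψ 1)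

theorem exists_word_of_mem_nodes {ψ : Fin 2 → ℝ → ℝ} {k : ℕ} {x : ℝ} (hx : x ∈ nodes ψ k) :
    ∃ w : List (Fin 2), w.length = k ∧ x = listMap ψ w 1 := by
  induction k generalizing x with
  | zero => exact ⟨[], rfl, by simpa [nodes, listMap] using hx⟩
  | succ k ih =>
    simp only [nodes, Finset.mem_union, Finset.mem_image] at hx
    rcases hx with ⟨y, hy, rfl⟩ | ⟨y, hy, rfl⟩
    · obtain ⟨w, hw, rfl⟩ := ih hy
      exact ⟨0 :: w, by simp [hw], rfl⟩
    · obtain ⟨w, hw, rfl⟩ := ih hy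
      exact ⟨1 :: w, by simp [hw], rfl⟩

namespace IsSlopePair

variable {s r : ℝ} {ψ : Fin 2 → ℝ → ℝ}

theorem nodes_subset (h : IsSlopePair s r ψ) {k : ℕ} {x : ℝ} (hx : x ∈ nodes ψ k) :
    x ∈ Icc (0 : ℝ) 1 := by
  obtain ⟨w, -, rfl⟩ := exists_word_of_mem_nodes hx
  exact h.listMap_mem w (by simp)

theorem disjoint_image_nodes (h : IsSlopePair s r ψ) {i j : Fin 2} (hij : i ≠ j) (k : ℕ) :
    Disjoint ((nodes ψ k).image (ψ i)) ((nodes ψ k).image (ψ j)) := by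
  rw [Finset.disjoint_left]
  intro x hx hy
  obtain ⟨y, hy, rfl⟩ := Finset.mem_image.1 hx
  obtain ⟨z, hz, e⟩ := Finset.mem_image.1 hy
  exact Set.disjoint_left.1 (h.isIHIFS.disjoint i j hij) ⟨y, h.nodes_subset (by assumption), rfl⟩
    ⟨z, h.nodes_subset hz, e⟩

theorem injOn_nodes (h : IsSlopePair s r ψ) (i : Fin 2) (k : ℕ) :
    InjOn (ψ i) (nodes ψ k : Set ℝ) :=
  (h.isIHIFS.injOn i).mono fun _ hx => h.nodes_subset hx

theorem card_nodes (h : IsSlopePair s r ψ) (k : ℕ) : (nodes ψ k).card = 2 ^ k := by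
  induction k with
  | zero => simp [nodes]
  | succ k ih =>
    rw [nodes, Finset.card_union_of_disjoint (h.disjoint_image_nodes (by decide) k),
      Finset.card_image_of_injOn (h.injOn_nodes 0 k),
      Finset.card_image_of_injOn (h.injOn_nodes 1 k), ih]
    ring

/-- The nodes are well spread: the products of their mutual distances are at most exponentially
small in their number. -/
theorem pow_le_prod_nodes (h : IsSlopePair s r ψ) {k : ℕ} {x : ℝ} (hx : x ∈ nodes ψ k) :
    ((1 - 2 * r) * s) ^ 2 ^ k ≤ ∏ y ∈ (nodes ψ k).erase x, |x - y| := by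
  have h0 := h.pos
  have h1 := h.lt_half
  have h2 := h.le
  have hγ : 0 < 1 - 2 * r := by linarith
  induction k generalizing x with
  | zero =>
    have : x = 1 := by simpa [nodes] using hx
    subst this
    have : (1 - 2 * r) * s ≤ 1 := mul_le_one₀ (by linarith) h0.le (by linarith)
    simpa [nodes] using this
  | succ k ih =>
    -- Nodes in the same half are images of level-`k` nodes, with distances shrunk by at most `s`;
    -- the `2 ^ k` nodes of the other half are at distance at least `1 - 2 * r`. The induction
    -- closes because the two factors combine to `((1 - 2 * r) * s) ^ 2 ^ k`.
    have key : ∀ i j : Fin 2, i ≠ j → ∀ x ∈ nodes ψ k, ((1 - 2 * r) * s) ^ 2 ^ (k + 1) ≤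
        ∏ y ∈ ((nodes ψ k).image (ψ i) ∪ (nodes ψ k).image (ψ j)).erase (ψ i x),
          |ψ i x - y| := by
      intro i j hij x hx
      have hxI := h.nodes_subset hx
      have hnot : ψ i x ∉ (nodes ψ k).image (ψ j) :=
        Finset.disjoint_left.1 (h.disjoint_image_nodes hij k) (Finset.mem_image_of_mem _ hx)
      have hset : ((nodes ψ k).image (ψ i) ∪ (nodes ψ k).image (ψ j)).erase (ψ i x) =
          ((nodes ψ k).erase x).image (ψ i) ∪ (nodes ψ k).image (ψ j) := by
        rw [Finset.erase_union_distrib, Finset.erase_eq_of_notMem hnot]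
        congr 1
        ext y
        simp only [Finset.mem_erase, Finset.mem_image]
        constructor
        · rintro ⟨hne, z, hz, rfl⟩
          exact ⟨z, ⟨fun e => hne (by rw [e]), hz⟩, rfl⟩
        · rintro ⟨z, ⟨hne, hz⟩, rfl⟩
          exact ⟨fun e => hne (h.injOn_nodes i k hz hx e), z, hz, rfl⟩
      rw [hset, Finset.prod_union ((h.disjoint_image_nodes hij k).mono_left
        (Finset.image_subset_image (Finset.erase_subset _ _))),
        Finset.prod_image ((h.injOn_nodes i k).mono (by simp)),
        Finset.prod_image (h.injOn_nodes j k)]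
      have hA : s ^ 2 ^ k * ((1 - 2 * r) * s) ^ 2 ^ k ≤
          ∏ y ∈ (nodes ψ k).erase x, |ψ i x - ψ i y| := by
        calc s ^ 2 ^ k * ((1 - 2 * r) * s) ^ 2 ^ k
            ≤ s ^ ((nodes ψ k).erase x).card * ∏ y ∈ (nodes ψ k).erase x, |x - y| := by
              refine mul_le_mul ?_ (ih hx) (by positivity) (by positivity)
              refine pow_le_pow_of_le_one h0.le (by linarith) ?_
              rw [← h.card_nodes k]
              exact Finset.card_le_card (Finset.erase_subset _ _)
          _ = ∏ y ∈ (nodes ψ k).erase x, s * |x - y| := by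
              rw [Finset.prod_mul_distrib, Finset.prod_const]
          _ ≤ _ := Finset.prod_le_prod (fun _ _ => by positivity) fun y hy =>
              (h.abs_slope i hxI (h.nodes_subset (Finset.mem_of_mem_erase hy))).1
      have hB : (1 - 2 * r) ^ 2 ^ k ≤ ∏ y ∈ nodes ψ k, |ψ i x - ψ j y| := by
        rw [← h.card_nodes k, ← Finset.prod_const]
        exact Finset.prod_le_prod (fun _ _ => hγ.le) fun y hy =>
          h.gap hij hxI (h.nodes_subset hy)
      calc ((1 - 2 * r) * s) ^ 2 ^ (k + 1)
          = s ^ 2 ^ k * ((1 - 2 * r) * s) ^ 2 ^ k * (1 - 2 * r) ^ 2 ^ k := by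
            rw [pow_succ 2 k, pow_mul, sq, mul_pow]; ring
        _ ≤ _ := mul_le_mul hA hB (by positivity)
            (Finset.prod_nonneg fun _ _ => abs_nonneg _)
    rw [nodes] at hx ⊢
    rcases Finset.mem_union.1 hx with hx | hx
    · obtain ⟨y, hy, rfl⟩ := Finset.mem_image.1 hx
      exact key 0 1 (by decide) y hy
    · obtain ⟨y, hy, rfl⟩ := Finset.mem_image.1 hx
      rw [Finset.union_comm]
      exact key 1 0 (by decide) y hy

end IsSlopePair

/-! ### Coefficients of interpolation polynomials -/

-- Multiplying by `X - y` with `|y| ≤ 1` at most doubles a uniform bound on coefficients, and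
-- normalization divides by `|x - y|`.
open Polynomial in
theorem abs_coeff_prod_basisDivisor_le (t : Finset ℝ) (ht : ∀ y ∈ t, |y| ≤ 1) (x : ℝ) (j : ℕ) :
    |(∏ y ∈ t, Lagrange.basisDivisor x y).coeff j| ≤ 2 ^ t.card * (∏ y ∈ t, |x - y|)⁻¹ := by
  induction t using Finset.induction_on generalizing j with
  | empty =>
    simp only [Finset.prod_empty, Finset.card_empty, coeff_one]
    split_ifs <;> simp
  | insert y t hy ih =>
    have ih' := ih fun z hz => ht z (Finset.mem_insert_of_mem hz)
    have hy1 := ht y (Finset.mem_insert_self _ _)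
    rw [Finset.prod_insert hy, Finset.prod_insert hy, Finset.card_insert_of_notMem hy,
      Lagrange.basisDivisor, mul_assoc, coeff_C_mul, abs_mul, abs_inv, mul_inv, pow_succ']
    set P := ∏ y ∈ t, Lagrange.basisDivisor x y
    set M := 2 ^ t.card * (∏ y ∈ t, |x - y|)⁻¹
    have hM : |((X - C y) * P).coeff j| ≤ 2 * M := by
      rw [sub_mul, coeff_sub, coeff_C_mul]
      have h1 : |(X * P).coeff j| ≤ M := by
        cases j with
        | zero => simpa using (abs_nonneg _).trans (ih' 0)
        | succ j => simpa [coeff_X_mul] using ih' j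
      have h2 : |y * P.coeff j| ≤ M := by
        rw [abs_mul]
        exact (mul_le_of_le_one_left (abs_nonneg _) hy1).trans (ih' j)
      linarith [abs_sub ((X * P).coeff j) (y * P.coeff j)]
    calc |x - y|⁻¹ * |((X - C y) * P).coeff j| ≤ |x - y|⁻¹ * (2 * M) :=
          mul_le_mul_of_nonneg_left hM (by positivity)
      _ = _ := by ring

open Polynomial in
/-- A polynomial that is small at well-spread nodes has small coefficients. -/
theorem abs_coeff_le_of_abs_eval_le {S : Finset ℝ} (hS : ∀ y ∈ S, |y| ≤ 1) {D E : ℝ}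
    (hD : 0 < D) (hprod : ∀ x ∈ S, D ≤ ∏ y ∈ S.erase x, |x - y|) {p : ℝ[X]}
    (hdeg : p.degree < S.card) (hE : ∀ x ∈ S, |p.eval x| ≤ E) (j : ℕ) :
    |p.coeff j| ≤ S.card * (E * (2 ^ S.card * D⁻¹)) := by
  -- The degree bound makes the polynomial equal to its Lagrange interpolant, whose basis
  -- polynomials have controlled coefficients.
  have hp := Lagrange.eq_interpolate (s := S) (v := id) (Set.injOn_id _) hdeg
  rw [hp, Lagrange.interpolate_apply, finsetSum_coeff, ← nsmul_eq_mul]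
  refine (Finset.abs_sum_le_sum_abs _ _).trans (Finset.sum_le_card_nsmul _ _ _ fun x hx => ?_)
  rw [coeff_C_mul, abs_mul]
  have hE0 : 0 ≤ E := (abs_nonneg _).trans (hE x hx)
  refine mul_le_mul (hE x hx) ?_ (abs_nonneg _) hE0
  refine (abs_coeff_prod_basisDivisor_le (S.erase x)
    (fun y hy => hS y (Finset.mem_of_mem_erase hy)) x j).trans ?_
  refine mul_le_mul (pow_le_pow_right₀ one_le_two
    (Finset.card_le_card (Finset.erase_subset _ _))) (inv_anti₀ hD (hprod x hx))
    (by positivity) (by positivity)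

/-! ### Slopes of analytic maps -/

theorem ofReal_mem_ball {R : ℝ} (hR : 1 / 2 < R) {x : ℝ} (hx : x ∈ Icc (0 : ℝ) 1) :
    (x : ℂ) ∈ Metric.ball (1 / 2 : ℂ) R := by
  rw [Metric.mem_ball, dist_eq_norm]
  have : (x : ℂ) - 1 / 2 = ((x - 1 / 2 : ℝ) : ℂ) := by push_cast; ring
  rw [this, Complex.norm_real, Real.norm_eq_abs]
  refine lt_of_le_of_lt (abs_le.2 ⟨?_, ?_⟩) hR <;> linarith [hx.1, hx.2]

theorem slope_re_of_deriv {R s r : ℝ} (hR : 1 / 2 < R) {f : ℂ → ℂ}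
    (hf : DifferentiableOn ℂ f (Metric.ball (1 / 2 : ℂ) R))
    (hd : ∀ x ∈ Icc (0 : ℝ) 1, s ≤ (deriv f (x : ℂ)).re ∧ (deriv f (x : ℂ)).re ≤ r)
    {x y : ℝ} (hx : x ∈ Icc (0 : ℝ) 1) (hy : y ∈ Icc (0 : ℝ) 1) (hxy : x ≤ y) :
    s * (y - x) ≤ (f y).re - (f x).re ∧ (f y).re - (f x).re ≤ r * (y - x) := by
  have hD : ∀ u ∈ Icc (0 : ℝ) 1,
      HasDerivAt (fun v : ℝ => (f v).re) (deriv f (u : ℂ)).re u := fun u hu =>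
    ((hf.differentiableAt (Metric.isOpen_ball.mem_nhds
      (ofReal_mem_ball hR hu))).hasDerivAt).real_of_complex
  have hc : ContinuousOn (fun v : ℝ => (f v).re) (Icc 0 1) :=
    fun u hu => (hD u hu).continuousAt.continuousWithinAt
  have hdi : DifferentiableOn ℝ (fun v : ℝ => (f v).re) (interior (Icc 0 1)) :=
    fun u hu => (hD u (interior_subset hu)).differentiableAt.differentiableWithinAt
  constructor
  · refine (convex_Icc (0 : ℝ) 1).mul_sub_le_image_sub_of_le_deriv hc hdi (fun u hu => ?_)
      x hx y hy hxy
    rw [(hD u (interior_subset hu)).deriv]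
    exact (hd u (interior_subset hu)).1
  · refine (convex_Icc (0 : ℝ) 1).image_sub_le_mul_sub_of_deriv_le hc hdi (fun u hu => ?_)
      x hx y hy hxy
    rw [(hD u (interior_subset hu)).deriv]
    exact (hd u (interior_subset hu)).2

theorem isSlopePair_realMaps {R s r Q : ℝ} (hR : 1 / 2 < R) (hs : 0 < s) (hr : r < 1 / 2)
    {φ : Fin 2 → ℂ → ℂ} (hφ : φ ∈ analyticPairs R s r Q) : IsSlopePair s r (realMaps φ) where
  pos := hs
  lt_half := hr
  zero := by simp [realMaps, hφ.2.1]
  one := by simp [realMaps, hφ.2.2]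
  slope i _ hx _ hy hxy :=
    slope_re_of_deriv hR (hφ.1 i).1.differentiableOn (hφ.1 i).2.2.2 hx hy hxy

theorem analyticOnNhd_realMaps {R s r Q : ℝ} (hR : 1 / 2 < R) {φ : Fin 2 → ℂ → ℂ}
    (hφ : φ ∈ analyticPairs R s r Q) (i : Fin 2) :
    AnalyticOnNhd ℝ (realMaps φ i) (Icc 0 1) := fun _ hx =>
  ((hφ.1 i).1 _ (ofReal_mem_ball hR hx)).re_ofReal

/-! ### Coding sequences of blocks of integers in an analytic map -/

/-- A block of `2 ^ k` integers of `2 ^ k` binary digits each. -/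
abbrev Block (k : ℕ) := Fin (2 ^ k) → Fin (2 ^ 2 ^ k)

/-- The polynomial that carries a block. -/
noncomputable def blockPoly (a : ℝ) (k : ℕ) (c : Block k) : Polynomial ℝ :=
  ∑ j, Polynomial.C (a ^ 2 ^ k * ((c j : ℕ) : ℝ)) * Polynomial.X ^ (j : ℕ)

/-- The analytic function that carries a sequence of blocks. -/
noncomputable def blockSeries (a : ℝ) (b : ∀ k, Block k) (z : ℂ) : ℂ :=
  ∑' k, Polynomial.aeval z (blockPoly a k (b k))

theorem degree_blockPoly_lt (a : ℝ) (k : ℕ) (c : Block k) :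
    (blockPoly a k c).degree < (2 ^ k : ℕ) := by
  refine (Polynomial.degree_sum_le _ _).trans_lt ((Finset.sup_lt_iff ?_).2 fun j _ => ?_)
  · exact WithBot.bot_lt_coe _
  · exact (Polynomial.degree_C_mul_X_pow_le _ _).trans_lt (by exact_mod_cast j.2)

theorem coeff_blockPoly (a : ℝ) (k : ℕ) (c : Block k) (j : Fin (2 ^ k)) :
    (blockPoly a k c).coeff j = a ^ 2 ^ k * ((c j : ℕ) : ℝ) := by
  rw [blockPoly, Polynomial.finsetSum_coeff, Finset.sum_eq_single j]
  · rw [Polynomial.coeff_C_mul_X_pow, if_pos rfl]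
  · intro i _ hij
    rw [Polynomial.coeff_C_mul_X_pow, if_neg fun e => hij (Fin.ext e.symm)]
  · simp

/-- With `K = 2 ^ k`, each of the `K` terms is at most `(2 * a * B) ^ K`; the number of terms is
absorbed by a second factor `2 ^ K`. -/
theorem norm_aeval_blockPoly_le {a B : ℝ} (ha : 0 ≤ a) (hB : 1 ≤ B) (k : ℕ) (c : Block k)
    {z : ℂ} (hz : ‖z‖ ≤ B) :
    ‖Polynomial.aeval z (blockPoly a k c)‖ ≤ (4 * a * B) ^ 2 ^ k := by
  rw [blockPoly, map_sum]
  have key : ∀ j : Fin (2 ^ k), ‖Polynomial.aeval z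
      (Polynomial.C (a ^ 2 ^ k * ((c j : ℕ) : ℝ)) * Polynomial.X ^ (j : ℕ))‖ ≤
      a ^ 2 ^ k * 2 ^ 2 ^ k * B ^ 2 ^ k := by
    intro j
    have h1 : ((c j : ℕ) : ℝ) ≤ 2 ^ 2 ^ k := by exact_mod_cast (c j).2.le
    have h2 : ‖z‖ ^ (j : ℕ) ≤ B ^ 2 ^ k :=
      (pow_le_pow_left₀ (norm_nonneg z) hz _).trans (pow_le_pow_right₀ hB j.2.le)
    rw [map_mul, map_pow, Polynomial.aeval_X, Polynomial.aeval_C, norm_mul, norm_pow,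
      norm_algebraMap', Real.norm_eq_abs, abs_of_nonneg (by positivity)]
    exact mul_le_mul (mul_le_mul_of_nonneg_left h1 (by positivity)) h2 (by positivity)
      (by positivity)
  refine (norm_sum_le _ _).trans ((Finset.sum_le_card_nsmul _ _ _ fun j _ => key j).trans ?_)
  have h3 : ((2 ^ k : ℕ) : ℝ) ≤ 2 ^ 2 ^ k := by exact_mod_cast Nat.lt_two_pow_self.le
  rw [Finset.card_univ, Fintype.card_fin, nsmul_eq_mul]
  calc ((2 ^ k : ℕ) : ℝ) * (a ^ 2 ^ k * 2 ^ 2 ^ k * B ^ 2 ^ k)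
      ≤ 2 ^ 2 ^ k * (a ^ 2 ^ k * 2 ^ 2 ^ k * B ^ 2 ^ k) :=
        mul_le_mul_of_nonneg_right h3 (by positivity)
    _ = _ := by
        rw [← mul_pow, ← mul_pow, ← mul_pow]
        congr 1
        ring

/-- Doubly exponential decay dominates geometric decay, since `2 ^ n + i ≤ 2 ^ (i + n)`. Hence a
tail of the series is at most twice the bound for its first term. -/
theorem pow_two_pow_add_le {t : ℝ} (ht0 : 0 ≤ t) (ht : t ≤ 1 / 2) (n i : ℕ) :
    t ^ 2 ^ (i + n) ≤ t ^ 2 ^ n * (1 / 2) ^ i := by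
  have h1 : 2 ^ n + i ≤ 2 ^ (i + n) := by
    have h2 : i + 1 ≤ 2 ^ i := Nat.lt_two_pow_self
    have h3 : 1 ≤ 2 ^ n := Nat.one_le_two_pow
    rw [pow_add]
    nlinarith
  calc t ^ 2 ^ (i + n) ≤ t ^ (2 ^ n + i) := pow_le_pow_of_le_one ht0 (by linarith) h1
    _ = t ^ 2 ^ n * t ^ i := pow_add _ _ _
    _ ≤ _ := mul_le_mul_of_nonneg_left (pow_le_pow_left₀ ht0 ht i) (by positivity)

theorem summable_pow_two_pow {t : ℝ} (ht0 : 0 ≤ t) (ht : t ≤ 1 / 2) :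
    Summable fun k : ℕ => t ^ 2 ^ k :=
  Summable.of_nonneg_of_le (fun _ => by positivity) (fun k => pow_two_pow_add_le ht0 ht 0 k)
    (summable_geometric_two.mul_left _)

theorem norm_blockSeries_sub_le {a B : ℝ} (ha : 0 ≤ a) (hB : 1 ≤ B) (ht : 4 * a * B ≤ 1 / 2)
    (b : ∀ k, Block k) {z : ℂ} (hz : ‖z‖ ≤ B) (n : ℕ) :
    ‖blockSeries a b z - ∑ k ∈ Finset.range n, Polynomial.aeval z (blockPoly a k (b k))‖ ≤
      2 * (4 * a * B) ^ 2 ^ n := by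
  have ht0 : 0 ≤ 4 * a * B := by positivity
  have hs : Summable fun k => Polynomial.aeval z (blockPoly a k (b k)) :=
    Summable.of_norm_bounded (summable_pow_two_pow ht0 ht) fun k =>
      norm_aeval_blockPoly_le ha hB k (b k) hz
  rw [blockSeries, ← hs.sum_add_tsum_nat_add n, add_sub_cancel_left]
  refine tsum_of_norm_bounded (g := fun i => (4 * a * B) ^ 2 ^ n * (1 / 2 : ℝ) ^ i) ?_
    fun i => (norm_aeval_blockPoly_le ha hB _ _ hz).trans (pow_two_pow_add_le ht0 ht n i)
  simpa only [mul_comm _ (2 : ℝ)] using hasSum_geometric_two.mul_left ((4 * a * B) ^ 2 ^ n)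

theorem norm_blockSeries_le {a B : ℝ} (ha : 0 ≤ a) (hB : 1 ≤ B) (ht : 4 * a * B ≤ 1 / 2)
    (b : ∀ k, Block k) {z : ℂ} (hz : ‖z‖ ≤ B) : ‖blockSeries a b z‖ ≤ 2 * (4 * a * B) := by
  simpa using norm_blockSeries_sub_le ha hB ht b hz 0

/-- The distance between two series is governed by the first blocks that differ. -/
theorem norm_blockSeries_sub_blockSeries_le {a B : ℝ} (ha : 0 ≤ a) (hB : 1 ≤ B)
    (ht : 4 * a * B ≤ 1 / 2) (b b' : ∀ k, Block k) {z : ℂ} (hz : ‖z‖ ≤ B) (n : ℕ)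
    (hbb : ∀ k < n, b k = b' k) :
    ‖blockSeries a b z - blockSeries a b' z‖ ≤ 4 * (4 * a * B) ^ 2 ^ n ∧
    ‖blockSeries a b z - blockSeries a b' z -
      Polynomial.aeval z (blockPoly a n (b n) - blockPoly a n (b' n))‖ ≤
        4 * (4 * a * B) ^ 2 ^ (n + 1) := by
  have hsum : ∑ k ∈ Finset.range n, Polynomial.aeval z (blockPoly a k (b k)) =
      ∑ k ∈ Finset.range n, Polynomial.aeval z (blockPoly a k (b' k)) :=
    Finset.sum_congr rfl fun k hk => by rw [hbb k (Finset.mem_range.1 hk)]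
  have key : ∀ m, ‖blockSeries a b z - blockSeries a b' z -
      (∑ k ∈ Finset.range m, Polynomial.aeval z (blockPoly a k (b k)) -
        ∑ k ∈ Finset.range m, Polynomial.aeval z (blockPoly a k (b' k)))‖ ≤
      4 * (4 * a * B) ^ 2 ^ m := by
    intro m
    rw [sub_sub_sub_comm]
    refine (norm_sub_le _ _).trans ?_
    linarith [norm_blockSeries_sub_le ha hB ht b hz m, norm_blockSeries_sub_le ha hB ht b' hz m]
  constructor
  · simpa [hsum] using key n
  · have := key (n + 1)
    rwa [Finset.sum_range_succ, Finset.sum_range_succ, hsum, add_sub_add_left_eq_sub,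
      ← map_sub] at this

theorem differentiableOn_blockSeries {a B : ℝ} (ha : 0 ≤ a) (hB : 1 ≤ B)
    (ht : 4 * a * B ≤ 1 / 2) (b : ∀ k, Block k) :
    DifferentiableOn ℂ (blockSeries a b) (Metric.ball 0 B) := by
  refine Complex.differentiableOn_tsum_of_summable_norm
    (summable_pow_two_pow (by positivity) ht) (fun k => ?_) Metric.isOpen_ball fun k z hz =>
      norm_aeval_blockPoly_le ha hB k (b k) (mem_ball_zero_iff.1 hz).le
  exact (Polynomial.differentiable_aeval _).differentiableOn

theorem im_blockSeries_ofReal (a : ℝ) (b : ∀ k, Block k) (x : ℝ) :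
    (blockSeries a b x).im = 0 := by
  have : blockSeries a b x = ((∑' k, (blockPoly a k (b k)).eval x : ℝ) : ℂ) := by
    rw [Complex.ofReal_tsum]
    exact tsum_congr fun k => Polynomial.aeval_algebraMap_apply_eq_algebraMap_eval x _
  rw [this, Complex.ofReal_im]

/-- The pair of analytic maps that carries a sequence of blocks. -/
noncomputable def blockPair (l a : ℝ) (b : ∀ k, Block k) : Fin 2 → ℂ → ℂ :=
  ![fun z => z * (l + blockSeries a b z), fun z => 1 - l + l * z]

/-- The slope `l` is the midpoint of `[s, r]`, so a perturbation `z * f z` is harmless if its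
derivative is at most `(r - s) / 2` on `[0, 1]`. Cauchy's estimate on circles of radius `1` gives
this, the radius `B = R + 2` leaving room for them. The bound by `Q` survives because `l < 1 / 2`
leaves room for the perturbation. -/
theorem blockPair_mem_analyticPairs {R s r Q a : ℝ} (hR : 1 / 2 < R) (hs : 0 < s) (hsr : s < r)
    (hr : r < 1 / 2) (hQ : 1 + R / 2 < Q) (ha : 0 ≤ a) (ht : 4 * a * (R + 2) ≤ 1 / 2)
    (hat : 4 * (R + 2) * (4 * a * (R + 2)) ≤ r - s) (b : ∀ k, Block k) :
    blockPair ((s + r) / 2) a b ∈ analyticPairs R s r Q := by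
  set B := R + 2 with hBdef
  set t := 4 * a * B with htdef
  set l := (s + r) / 2 with hl
  have hB : 1 ≤ B := by linarith
  have hl0 : 0 < l := by linarith
  have hl1 : l < 1 / 2 := by linarith
  have hball : Metric.ball (1 / 2 : ℂ) R ⊆ Metric.ball 0 B := by
    refine Metric.ball_subset_ball' ?_
    rw [dist_zero_right]
    norm_num
    linarith
  have hd0 : DifferentiableOn ℂ (fun z => z * (l + blockSeries a b z)) (Metric.ball 0 B) :=
    differentiableOn_id.mul ((differentiableOn_const _).add
      (differentiableOn_blockSeries ha hB ht b))
  have hd1 : Differentiable ℂ (fun z : ℂ => 1 - (l : ℂ) + l * z) := by fun_prop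
  have hnorm : ∀ z ∈ Metric.ball (1 / 2 : ℂ) R, ‖z - 1 / 2‖ < R := fun z hz => by
    simpa [dist_eq_norm] using hz
  have hderiv0 : ∀ x ∈ Icc (0 : ℝ) 1,
      s ≤ (deriv (fun z => z * (l + blockSeries a b z)) (x : ℂ)).re ∧
      (deriv (fun z => z * (l + blockSeries a b z)) (x : ℂ)).re ≤ r := by
    intro x hx
    have hxn : ‖(x : ℂ)‖ ≤ 1 := by
      rw [Complex.norm_real, Real.norm_eq_abs, abs_of_nonneg hx.1]
      exact hx.2
    have hcb : Metric.closedBall (x : ℂ) 1 ⊆ Metric.ball 0 B := by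
      refine Metric.closedBall_subset_ball' ?_
      rw [dist_zero_right]
      linarith
    have hdz : DifferentiableOn ℂ (fun z => z * blockSeries a b z) (Metric.ball 0 B) :=
      differentiableOn_id.mul (differentiableOn_blockSeries ha hB ht b)
    have hC : ‖deriv (fun z => z * blockSeries a b z) (x : ℂ)‖ ≤ (r - s) / 2 / 1 := by
      refine Complex.norm_deriv_le_of_forall_mem_sphere_norm_le one_pos
        ((hdz.mono hcb).diffContOnCl_ball le_rfl) fun z hz => ?_
      have hz' : ‖z‖ ≤ B :=
        (mem_ball_zero_iff.1 (hcb (Metric.sphere_subset_closedBall hz))).le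
      rw [norm_mul]
      have := mul_le_mul hz' (norm_blockSeries_le ha hB ht b hz') (norm_nonneg _) (by linarith)
      linarith
    have hxb : (x : ℂ) ∈ Metric.ball (0 : ℂ) B := hcb (Metric.mem_closedBall_self zero_le_one)
    have hdx := (hdz.differentiableAt (Metric.isOpen_ball.mem_nhds hxb)).hasDerivAt
    have hsum := ((hasDerivAt_id (x : ℂ)).mul_const (l : ℂ)).add hdx
    have hfun : (fun z => z * (l + blockSeries a b z)) =
        (fun z : ℂ => id z * (l : ℂ)) + fun z => z * blockSeries a b z := by
      ext z
      simp only [Pi.add_apply, id]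
      ring
    rw [hfun, hsum.deriv, one_mul, Complex.add_re, Complex.ofReal_re]
    have := abs_le.1 ((Complex.abs_re_le_norm _).trans hC)
    constructor <;> linarith [this.1, this.2]
  have hderiv1 : ∀ x ∈ Icc (0 : ℝ) 1,
      s ≤ (deriv (fun z : ℂ => 1 - (l : ℂ) + l * z) (x : ℂ)).re ∧
      (deriv (fun z : ℂ => 1 - (l : ℂ) + l * z) (x : ℂ)).re ≤ r := by
    intro x _
    have h1 : HasDerivAt (fun z : ℂ => 1 - (l : ℂ) + l * z) (l * 1) (x : ℂ) :=
      ((hasDerivAt_id (x : ℂ)).const_mul (l : ℂ)).const_add _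
    rw [h1.deriv, mul_one, Complex.ofReal_re]
    constructor <;> linarith
  refine ⟨fun i => ?_, by simp [blockPair], by simp [blockPair]⟩
  fin_cases i
  · refine ⟨(hd0.mono hball).analyticOnNhd Metric.isOpen_ball, fun z hz => ?_, fun x hx => ?_,
      hderiv0⟩
    · change ‖z * (l + blockSeries a b z)‖ ≤ Q
      have hz1 : ‖z‖ ≤ B := (mem_ball_zero_iff.1 (hball hz)).le
      have hz2 : ‖z‖ ≤ R + 1 / 2 := by
        calc ‖z‖ = ‖(z - 1 / 2) + 1 / 2‖ := by rw [sub_add_cancel]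
          _ ≤ ‖z - 1 / 2‖ + ‖(1 / 2 : ℂ)‖ := norm_add_le _ _
          _ ≤ R + 1 / 2 := by
            have := hnorm z hz
            norm_num at this ⊢
            exact this.le
      have h1 : ‖z * (l : ℂ)‖ ≤ (R + 1 / 2) * l := by
        rw [norm_mul, Complex.norm_real, Real.norm_eq_abs, abs_of_pos hl0]
        exact mul_le_mul_of_nonneg_right hz2 hl0.le
      have h2 : ‖z * blockSeries a b z‖ ≤ B * (2 * t) := by
        rw [norm_mul]
        exact mul_le_mul hz1 (norm_blockSeries_le ha hB ht b hz1) (norm_nonneg _) (by linarith)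
      rw [mul_add]
      have h3 := norm_add_le (z * (l : ℂ)) (z * blockSeries a b z)
      nlinarith
    · have him : ((x : ℂ) * (l + blockSeries a b x)).im = 0 := by
        simp [Complex.mul_im, im_blockSeries_ofReal]
      have hsl := slope_re_of_deriv hR (hd0.mono hball) hderiv0 (x := 0) (y := x) (by simp) hx
        hx.1
      simp only [Complex.ofReal_zero, zero_mul, Complex.zero_re, sub_zero] at hsl
      refine ⟨_, ⟨(mul_nonneg hs.le hx.1).trans hsl.1, hsl.2.trans ?_⟩, ?_⟩
      · nlinarith [hx.1, hx.2]
      · exact Complex.ext (by simp [blockPair]) (by simpa [blockPair] using him)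
  · refine ⟨hd1.differentiableOn.analyticOnNhd Metric.isOpen_ball, fun z hz => ?_,
      fun x hx => ?_, hderiv1⟩
    · change ‖1 - (l : ℂ) + l * z‖ ≤ Q
      have h1 : 1 - (l : ℂ) + l * z = ((1 - l / 2 : ℝ) : ℂ) + l * (z - 1 / 2) := by
        push_cast
        ring
      have h2 : ‖(l : ℂ) * (z - 1 / 2)‖ ≤ l * R := by
        rw [norm_mul, Complex.norm_real, Real.norm_eq_abs, abs_of_pos hl0]
        exact mul_le_mul_of_nonneg_left (hnorm z hz).le hl0.le
      have h3 : ‖((1 - l / 2 : ℝ) : ℂ)‖ = 1 - l / 2 := by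
        rw [Complex.norm_real, Real.norm_eq_abs, abs_of_pos (by linarith)]
      rw [h1]
      have h4 := norm_add_le ((1 - l / 2 : ℝ) : ℂ) ((l : ℂ) * (z - 1 / 2))
      nlinarith
    · refine ⟨1 - l + l * x, ⟨?_, ?_⟩, by simp [blockPair]⟩
      · nlinarith [hx.1, hx.2]
      · nlinarith [hx.1, hx.2]

theorem abs_realMaps_blockPair_sub_le (l a : ℝ) (b b' : ∀ k, Block k) {H : ℝ} (hH : 0 ≤ H)
    {x : ℝ} (hx : x ∈ Icc (0 : ℝ) 1) (h : ‖blockSeries a b x - blockSeries a b' x‖ ≤ H)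
    (i : Fin 2) :
    |realMaps (blockPair l a b) i x - realMaps (blockPair l a b') i x| ≤ H := by
  fin_cases i
  · simp only [realMaps, blockPair, ← Complex.sub_re]
    refine (Complex.abs_re_le_norm _).trans ?_
    have : (x : ℂ) * (l + blockSeries a b x) - x * (l + blockSeries a b' x) =
        x * (blockSeries a b x - blockSeries a b' x) := by ring
    simp only [Fin.zero_eta, Matrix.cons_val_zero]
    rw [this, norm_mul, Complex.norm_real, Real.norm_eq_abs, abs_of_nonneg hx.1]
    exact (mul_le_of_le_one_left (norm_nonneg _) hx.2).trans h
  · simpa [realMaps, blockPair] using hH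

theorem realMaps_blockPair_zero_sub (l a : ℝ) (b b' : ∀ k, Block k) (x : ℝ) :
    realMaps (blockPair l a b) 0 x - realMaps (blockPair l a b') 0 x =
      x * (blockSeries a b x - blockSeries a b' x).re := by
  simp only [realMaps, blockPair, Matrix.cons_val_zero, Complex.mul_re, Complex.ofReal_re,
    Complex.ofReal_im, Complex.add_re, Complex.sub_re, zero_mul, sub_zero]
  ring

/-- Two sequences of blocks with the same beginning, whose attractors are close, have the same
next block. -/
theorem block_eq_of_hausdorffEDist_lt {s r l a B : ℝ} (ha : 0 < a) (hB : 1 ≤ B)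
    (ht : 4 * a * B ≤ 1 / 2) (ht1 : 11 * (4 * a * B) ≤ (1 - 2 * r) * s)
    (ht2 : 160 * B * (4 * a * B) < s * ((1 - 2 * r) * s)) {b b' : ∀ k, Block k}
    (hb : IsSlopePair s r (realMaps (blockPair l a b)))
    (hb' : IsSlopePair s r (realMaps (blockPair l a b'))) {k : ℕ} (hbb : ∀ i < k, b i = b' i)
    (hd : Metric.hausdorffEDist (attractor (realMaps (blockPair l a b)))
      (attractor (realMaps (blockPair l a b'))) < ENNReal.ofReal (3 * (4 * a * B) ^ 2 ^ (k + 1))) :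
    b k = b' k := by
  set t := 4 * a * B with htdef
  set K := 2 ^ k with hK
  set ψ := realMaps (blockPair l a b)
  set ψ' := realMaps (blockPair l a b')
  set κ := (1 - 2 * r) * s with hκ
  have ht0 : 0 < t := by positivity
  have hs := hb.pos
  have hr := hb.lt_half
  have hsr := hb.le
  have hκ0 : 0 < κ := mul_pos (by linarith) hs
  have hK1 : k + 1 ≤ K := Nat.lt_two_pow_self
  have hpow : t ^ 2 ^ (k + 1) = t ^ K * t ^ K := by rw [pow_succ 2 k, pow_mul, sq]
  rw [hpow] at hd
  have htK1 : t ^ K ≤ 1 := pow_le_one₀ ht0.le (by linarith)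
  have htK0 : 0 < t ^ K := by positivity
  have hxB : ∀ x ∈ Icc (0 : ℝ) 1, ‖(x : ℂ)‖ ≤ B := fun x hx => by
    rw [Complex.norm_real, Real.norm_eq_abs, abs_of_nonneg hx.1]
    exact hx.2.trans hB
  have hH : ∀ i, ∀ x ∈ Icc (0 : ℝ) 1, |ψ i x - ψ' i x| ≤ 4 * t ^ K := fun i x hx =>
    abs_realMaps_blockPair_sub_le l a b b' (by positivity) hx
      (norm_blockSeries_sub_blockSeries_le ha.le hB ht b b' (hxB x hx) k hbb).1 i
  -- Level `k` covers the nodes and level `k + 1` their images under the first map. The a priori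
  -- error `11 * t ^ K` fits below the separation of these levels because `11 * t ≤ κ` and `k + 1 ≤
  -- K`.
  have hword : ∀ w : List (Fin 2), w.length ≤ k + 1 →
      |listMap ψ w 1 - listMap ψ' w 1| ≤ 3 * (t ^ K * t ^ K) := by
    intro w hw
    refine hb.abs_endpoint_sub_le hb' hH hd w ?_
    calc 2 * (4 * t ^ K) + 3 * (t ^ K * t ^ K) ≤ 11 * t ^ K := by nlinarith
      _ ≤ 11 ^ K * t ^ K := by
          refine mul_le_mul_of_nonneg_right ?_ htK0.le
          exact le_self_pow₀ (by norm_num) (by omega)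
      _ = (11 * t) ^ K := (mul_pow _ _ _).symm
      _ ≤ κ ^ K := pow_le_pow_left₀ (by positivity) ht1 K
      _ = (1 - 2 * r) ^ K * s ^ K := mul_pow _ _ _
      _ ≤ (1 - 2 * r) * s ^ w.length := by
          refine mul_le_mul ?_ (pow_le_pow_of_le_one hs.le (by linarith) (by omega))
            (by positivity) (by linarith)
          exact pow_le_of_le_one (by linarith) (by linarith) (by omega)
  set p := blockPoly a k (b k) - blockPoly a k (b' k) with hp
  have hdeg : p.degree < (nodes ψ k).card := by
    rw [hb.card_nodes]
    exact (Polynomial.degree_sub_le _ _).trans_lt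
      (max_lt (degree_blockPoly_lt _ _ _) (degree_blockPoly_lt _ _ _))
  have heval : ∀ x ∈ nodes ψ k, |p.eval x| ≤ 10 * (t ^ K * t ^ K) / s ^ K := by
    intro x hx
    have hxI := hb.nodes_subset hx
    obtain ⟨w, hw, rfl⟩ := exists_word_of_mem_nodes hx
    set x := listMap ψ w 1
    set x' := listMap ψ' w 1
    have hx'I : x' ∈ Icc (0 : ℝ) 1 := hb'.listMap_mem w (by simp)
    have h1 : |x - x'| ≤ 3 * (t ^ K * t ^ K) := hword w (by omega)
    have h2 : |ψ 0 x - ψ' 0 x'| ≤ 3 * (t ^ K * t ^ K) := hword (0 :: w) (by simp [hw])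
    have h3 := (hb'.abs_slope 0 hxI hx'I).2
    -- Compare both values with `ψ' 0 x'`: the shifted endpoint and the shifted argument contribute
    -- at most `3 * t ^ (2 * K)` each.
    have h4 : |ψ 0 x - ψ' 0 x| ≤ 6 * (t ^ K * t ^ K) := by
      have h5 := abs_sub_le (ψ 0 x) (ψ' 0 x') (ψ' 0 x)
      rw [abs_sub_comm (ψ' 0 x')] at h5
      have h6 : r * |x - x'| ≤ 1 * |x - x'| :=
        mul_le_mul_of_nonneg_right (by linarith) (abs_nonneg _)
      linarith
    have hxs : s ^ K ≤ x := by
      refine le_trans ?_ (hb.pow_le_listMap_one w)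
      exact pow_le_pow_of_le_one hs.le (by linarith) (by omega)
    have hsK : 0 < s ^ K := by positivity
    have h7 : |(blockSeries a b x - blockSeries a b' x).re| ≤ 6 * (t ^ K * t ^ K) / s ^ K := by
      rw [realMaps_blockPair_zero_sub, abs_mul, abs_of_nonneg hxI.1] at h4
      rw [le_div_iff₀ hsK]
      refine le_trans ?_ h4
      rw [mul_comm]
      exact mul_le_mul_of_nonneg_right hxs (abs_nonneg _)
    have h8 := (norm_blockSeries_sub_blockSeries_le ha.le hB ht b b' (hxB x hxI) k hbb).2
    have h9 : Polynomial.aeval (x : ℂ) p = ((p.eval x : ℝ) : ℂ) :=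
      Polynomial.aeval_algebraMap_apply_eq_algebraMap_eval x p
    rw [← htdef, hpow, ← hp, h9] at h8
    have h10 := (Complex.abs_re_le_norm _).trans h8
    rw [Complex.sub_re, Complex.ofReal_re] at h10
    have h11 : 4 * (t ^ K * t ^ K) ≤ 4 * (t ^ K * t ^ K) / s ^ K :=
      le_div_self (by positivity) hsK (pow_le_one₀ hs.le (by linarith))
    have h12 : 10 * (t ^ K * t ^ K) / s ^ K =
        6 * (t ^ K * t ^ K) / s ^ K + 4 * (t ^ K * t ^ K) / s ^ K := by ring
    rw [h12]
    -- The total `10` is `6` from the endpoints plus `4` from the blocks after `k`.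
    have h13 := abs_sub_le (p.eval x) ((blockSeries a b x - blockSeries a b' x).re) 0
    rw [sub_zero, sub_zero, abs_sub_comm] at h13
    linarith
  have hcoef : ∀ j, |p.coeff j| < a ^ K := by
    intro j
    refine (abs_coeff_le_of_abs_eval_le (S := nodes ψ k) (D := κ ^ K) (fun y hy => ?_)
      (by positivity) (fun x hx => hb.pow_le_prod_nodes hx) hdeg heval j).trans_lt ?_
    · have := hb.nodes_subset hy
      rw [abs_of_nonneg this.1]
      exact this.2
    rw [hb.card_nodes, ← hK]
    have h1 : (K : ℝ) ≤ 2 ^ K := by exact_mod_cast Nat.lt_two_pow_self.le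
    have h2 : (10 : ℝ) ≤ 10 ^ K := le_self_pow₀ (by norm_num) (by omega)
    calc (K : ℝ) * (10 * (t ^ K * t ^ K) / s ^ K * (2 ^ K * (κ ^ K)⁻¹))
        ≤ 2 ^ K * (10 ^ K * (t ^ K * t ^ K) / s ^ K * (2 ^ K * (κ ^ K)⁻¹)) := by gcongr
      _ = (40 * (t * t) / (s * κ)) ^ K := by
          clear_value t κ K
          rw [show (40 : ℝ) = 2 * 10 * 2 by norm_num, div_pow, mul_pow, mul_pow, mul_pow, mul_pow,
            mul_pow]
          field_simp
      _ < a ^ K := by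
          refine pow_lt_pow_left₀ ?_ (by positivity) (by omega)
          -- One factor of `t * t` is `4 * a * B`, so `40 * (t * t) = a * (160 * B * t)`; this is
          -- where `160` comes from.
          rw [div_lt_iff₀ (by positivity)]
          have : a * (160 * B * t) < a * (s * κ) := mul_lt_mul_of_pos_left ht2 ha
          nlinarith
  funext j
  have h1 := hcoef j
  rw [hp, Polynomial.coeff_sub, coeff_blockPoly, coeff_blockPoly, ← mul_sub, abs_mul,
    abs_of_pos (by positivity : 0 < a ^ 2 ^ k)] at h1
  have h2 : |((b k j : ℕ) : ℝ) - ((b' k j : ℕ) : ℝ)| < 1 := by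
    by_contra hc
    exact absurd h1 (not_lt.2 (le_mul_of_one_le_right (by positivity) (not_lt.1 hc)))
  have h3 : |((b k j : ℕ) : ℤ) - ((b' k j : ℕ) : ℤ)| < 1 := by exact_mod_cast h2
  refine Fin.ext ?_
  have := Int.abs_lt_one_iff.1 h3
  omega

/-! ### Counting programs -/

theorem finite_lists_length_lt (n : ℕ) : {p : List Bool | p.length < n}.Finite :=
  List.finite_length_lt Bool n

theorem ncard_lists_length_lt (n : ℕ) : {p : List Bool | p.length < n}.ncard < 2 ^ n := by
  let f : (Σ i : Fin n, List.Vector Bool i) → List Bool := fun p => p.2.1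
  have hsub : {p : List Bool | p.length < n} ⊆ range f := fun p hp =>
    ⟨⟨⟨p.length, hp⟩, ⟨p, rfl⟩⟩, rfl⟩
  calc {p : List Bool | p.length < n}.ncard ≤ (range f).ncard :=
        ncard_le_ncard hsub (finite_range f)
    _ = (f '' univ).ncard := by rw [image_univ]
    _ ≤ (univ : Set (Σ i : Fin n, List.Vector Bool i)).ncard := ncard_image_le finite_univ
    _ = ∑ i ∈ Finset.range n, 2 ^ i := by
        rw [ncard_univ, Nat.card_eq_fintype_card, Fintype.card_sigma, Finset.sum_range]
        simp
    _ < 2 ^ n := Nat.geomSum_lt le_rfl fun k hk => Finset.mem_range.1 hk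

theorem card_block (k : ℕ) : Fintype.card (Block k) = 2 ^ 4 ^ k := by
  rw [Fintype.card_fun, Fintype.card_fin, Fintype.card_fin, ← pow_mul, ← mul_pow]
  norm_num

/-- If every short program excludes at most one value of the `k`-th block once the previous
blocks are given, then some sequence of blocks is not excluded by any short program. -/
theorem exists_blocks_not_excluded (E : ℕ → List Bool → (∀ k, Block k) → Prop)
    (hE : ∀ k p b b', (∀ i < k, b i = b' i) → E k p b → E k p b' → b k = b' k) :
    ∃ b : ∀ k, Block k, ∀ k p, p.length < 4 ^ k → ¬ E k p b := by
  have step : ∀ (k : ℕ) (b : ∀ k, Block k), ∃ c : Block k, ∀ b' : ∀ k, Block k,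
      (∀ i < k, b' i = b i) → b' k = c → ∀ p : List Bool, p.length < 4 ^ k → ¬ E k p b' := by
    intro k b
    by_contra! hc
    choose β hβ1 hβ2 π hπ1 hπ2 using hc
    -- If every value `c` were excluded, a short program `π c` would exclude some continuation
    -- through `c`. Each program serves only one value, so there would be at least `2 ^ 4 ^ k` short
    -- programs.
    have hinj : Function.Injective π := by
      intro c c' e
      rw [← hβ2 c, ← hβ2 c']
      exact hE k (π c) _ _ (fun i hi => by rw [hβ1 c i hi, hβ1 c' i hi]) (hπ2 c)
        (by rw [e]; exact hπ2 c')
    have h1 : (range π).ncard ≤ {p : List Bool | p.length < 4 ^ k}.ncard :=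
      ncard_le_ncard (range_subset_iff.2 hπ1) (finite_lists_length_lt _)
    rw [← image_univ, ncard_image_of_injective _ hinj, ncard_univ, Nat.card_eq_fintype_card,
      card_block] at h1
    exact absurd h1 (not_le.2 (ncard_lists_length_lt _))
  choose F hF using step
  -- Stage `n` fixes block `n` and never touches it again; the initial zeros are placeholders. The
  -- sequence sought is the diagonal of the stages.
  let β : ℕ → ∀ k, Block k := fun n =>
    Nat.rec (fun _ _ => 0) (fun n b => Function.update b n (F n b)) n
  have hβ : ∀ n, β (n + 1) = Function.update (β n) n (F n (β n)) := fun _ => rfl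
  have hstable : ∀ i n, i < n → β n i = β (i + 1) i := by
    intro i n hin
    induction n, hin using Nat.le_induction with
    | base => rfl
    | succ n hn ih =>
      rw [hβ n, Function.update_of_ne (by omega), ih]
  refine ⟨fun k => β (k + 1) k, fun k => hF k (β k) _ (fun i hi => (hstable i k hi).symm) ?_⟩
  rw [hβ k, Function.update_self]

/-! ### The lower bound for the distortion complexity -/

theorem distortionComplexity_anti (U : Machine) (F : Set ℝ) {ε ε' : ℝ} (h : ε ≤ ε') :
    distortionComplexity U ε' F ≤ distortionComplexity U ε F := by
  refine iInf_mono' fun p => ⟨p, iInf_mono' fun ⟨l, hl, hd⟩ => ⟨⟨l, hl, hd.trans ?_⟩, le_rfl⟩⟩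
  exact ENNReal.ofReal_le_ofReal h

theorem liminf_distortionComplexity_pos (U : Machine) (F : Set ℝ) {t : ℝ} (ht0 : 0 < t)
    (ht1 : t < 1)
    (h : ∀ k : ℕ, ((4 ^ k : ℕ) : ℕ∞) ≤ distortionComplexity U (t ^ 2 ^ (k + 1)) F) :
    0 < liminf (fun ε : ℝ => (distortionComplexity U ε F : ℝ≥0∞) /
      ENNReal.ofReal ((Real.log ε⁻¹) ^ 2)) (𝓝[>] 0) := by
  set L := Real.log t⁻¹ with hL
  have hL0 : 0 < L := Real.log_pos ((one_lt_inv₀ ht0).2 ht1)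
  -- For `t ^ 2 ^ (k + 2) < ε ≤ t ^ 2 ^ (k + 1)` the complexity is at least `4 ^ k`, while `(log
  -- ε⁻¹) ^ 2 ≤ (2 ^ (k + 2) * L) ^ 2 = 4 ^ k * (16 * L ^ 2)`.
  refine lt_of_lt_of_le (b := (ENNReal.ofReal (16 * L ^ 2))⁻¹)
    (ENNReal.inv_pos.2 ENNReal.ofReal_ne_top) (le_liminf_of_le (by isBoundedDefault) ?_)
  have h2 : (0 : ℝ) < t ^ 2 := by positivity
  -- The restriction `ε < t ^ 2` supplies the upper bound when the scale found is `k = 0`.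
  filter_upwards [Ioo_mem_nhdsGT h2] with ε hε
  have hex : ∃ n : ℕ, t ^ 2 ^ (n + 2) < ε := by
    obtain ⟨n, hn⟩ := exists_pow_lt_of_lt_one hε.1 ht1
    refine ⟨n, lt_of_le_of_lt (pow_le_pow_of_le_one ht0.le ht1.le ?_) hn⟩
    exact Nat.lt_two_pow_self.le.trans (Nat.pow_le_pow_right two_pos (by omega))
  obtain ⟨k, hk1, hk2⟩ : ∃ k : ℕ, t ^ 2 ^ (k + 2) < ε ∧ ε ≤ t ^ 2 ^ (k + 1) := by
    classical
    refine ⟨Nat.find hex, Nat.find_spec hex, ?_⟩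
    rcases hm : Nat.find hex with _ | m
    · simpa using hε.2.le
    · exact not_lt.1 (Nat.find_min hex (m := m) (by omega))
  have hlog : Real.log ε⁻¹ ≤ 2 ^ (k + 2) * L := by
    rw [Real.log_inv, hL, Real.log_inv]
    have := Real.log_le_log (by positivity) hk1.le
    rw [Real.log_pow] at this
    push_cast at this
    linarith
  have hlog0 : 0 < Real.log ε⁻¹ :=
    Real.log_pos ((one_lt_inv₀ hε.1).2 (hε.2.trans (pow_lt_one₀ ht0.le ht1 two_ne_zero)))
  have hsq : (Real.log ε⁻¹) ^ 2 ≤ (4 ^ k : ℕ) * (16 * L ^ 2) := by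
    calc (Real.log ε⁻¹) ^ 2 ≤ (2 ^ (k + 2) * L) ^ 2 := pow_le_pow_left₀ hlog0.le hlog 2
      _ = _ := by
        push_cast
        rw [show (4 : ℝ) = 2 ^ 2 by norm_num, ← pow_mul]
        ring
  have hΔ : ((4 ^ k : ℕ) : ℝ≥0∞) ≤ (distortionComplexity U ε F : ℝ≥0∞) := by
    have := (h k).trans (distortionComplexity_anti U F hk2)
    exact_mod_cast ENat.toENNReal_le.2 this
  have hc : (0 : ℝ) < 16 * L ^ 2 := by positivity
  rw [ENNReal.le_div_iff_mul_le
    (Or.inl (ENNReal.ofReal_pos.2 (pow_pos hlog0 2)).ne') (Or.inl ENNReal.ofReal_ne_top)]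
  refine le_trans ?_ hΔ
  rw [mul_comm, ← div_eq_mul_inv]
  refine ENNReal.div_le_of_le_mul ?_
  rw [← ENNReal.ofReal_natCast, ← ENNReal.ofReal_mul (by positivity)]
  exact ENNReal.ofReal_le_ofReal hsq

end DistortionComplexity

/-! ### Choice of the parameters and conclusion -/

open DistortionComplexity in
theorem mainTheorem1 (U : Machine) (hU : IsUniversal U)
    (R ρ' ρ Q : ℝ) (hR : 1 / 2 < R) (hρ' : 0 < ρ') (hρ'ρ : ρ' < ρ) (hρ : ρ < 1 / 2)
    (hQ : 1 + R / 2 < Q) :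
    ∃ φ ∈ analyticPairs R ρ' ρ Q,
      IsIHIFS (realMaps φ) ∧
      (∀ i, AnalyticOnNhd ℝ (realMaps φ i) (Icc 0 1)) ∧
      IsCantorSet (attractor (realMaps φ)) ∧
      0 < liminf
        (fun ε : ℝ =>
          (distortionComplexity U ε (attractor (realMaps φ)) : ℝ≥0∞) /
            ENNReal.ofReal ((Real.log ε⁻¹) ^ 2))
        (𝓝[>] 0) := by
  set κ := (1 - 2 * ρ) * ρ' with hκ
  have hκ0 : 0 < κ := mul_pos (by linarith) hρ'
  have hκs : 0 < ρ' * κ := mul_pos hρ' hκ0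
  have hB : 0 < R + 2 := by linarith
  -- The bounds on `t` serve, in order, convergence of the series, the slope range, separation of
  -- cylinders up to level `k + 1`, and absorption of the interpolation losses.
  obtain ⟨t, ht0, ht, hta, htb, htc⟩ : ∃ t : ℝ, 0 < t ∧ t ≤ 1 / 2 ∧ 4 * (R + 2) * t ≤ ρ - ρ' ∧
      11 * t ≤ κ ∧ 160 * (R + 2) * t < ρ' * κ := by
    have hlim : ∀ c d : ℝ, 0 < d → ∀ᶠ t : ℝ in 𝓝[>] 0, c * t < d := fun c d hd =>
      (((continuous_const_mul c).tendsto' 0 0 (by simp)).mono_left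
        nhdsWithin_le_nhds).eventually_lt_const hd
    obtain ⟨t, h1, h2, h3, h4, h5⟩ := ((hlim 1 (1 / 2) (by norm_num)).and
      ((hlim (4 * (R + 2)) (ρ - ρ') (by linarith)).and ((hlim 11 κ hκ0).and
      ((hlim (160 * (R + 2)) (ρ' * κ) hκs).and self_mem_nhdsWithin)))).exists
    exact ⟨t, h5, by linarith, h2.le, h3.le, h4⟩
  obtain ⟨a, ha, hat⟩ : ∃ a : ℝ, 0 < a ∧ 4 * a * (R + 2) = t :=
    ⟨t / (4 * (R + 2)), by positivity, by field_simp⟩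
  subst hat
  set l := (ρ' + ρ) / 2
  have hmem : ∀ b, blockPair l a b ∈ analyticPairs R ρ' ρ Q := fun b =>
    blockPair_mem_analyticPairs hR hρ' hρ'ρ hρ hQ ha.le ht hta b
  have hslope : ∀ b, IsSlopePair ρ' ρ (realMaps (blockPair l a b)) := fun b =>
    isSlopePair_realMaps hR hρ' hρ (hmem b)
  -- A program excludes at level `k` the sequences whose attractor it approximates within `t ^ 2 ^
  -- (k + 1)`. Two sequences excluded by the same program have attractors within twice that,
  -- strictly less than the factor `3` allowed for decoding.
  obtain ⟨b, hb⟩ := exists_blocks_not_excluded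
    (fun k p b => ∃ m ∈ U p, Metric.hausdorffEDist (attractor (realMaps (blockPair l a b)))
      (points m) ≤ ENNReal.ofReal ((4 * a * (R + 2)) ^ 2 ^ (k + 1))) (by
    rintro k p b b' hbb ⟨m, hm, hd⟩ ⟨m', hm', hd'⟩
    obtain rfl := Part.mem_unique hm hm'
    refine block_eq_of_hausdorffEDist_lt ha (by linarith) ht htb htc (hslope b) (hslope b') hbb ?_
    rw [Metric.hausdorffEDist_comm] at hd'
    refine (Metric.hausdorffEDist_triangle.trans (add_le_add hd hd')).trans_lt ?_
    have hpos : 0 < (4 * a * (R + 2)) ^ 2 ^ (k + 1) := by positivity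
    rw [← ENNReal.ofReal_add hpos.le hpos.le, ENNReal.ofReal_lt_ofReal_iff (by positivity)]
    linarith)
  refine ⟨blockPair l a b, hmem b, (hslope b).isIHIFS, analyticOnNhd_realMaps hR (hmem b),
    (hslope b).isCantorSet, liminf_distortionComplexity_pos U _ ht0 (by linarith) fun k => ?_⟩
  refine le_iInf₂ fun p hp => ?_
  exact_mod_cast not_lt.1 fun hlt => hb k p hlt hp
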